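/- Let $K$ be a number field with ring of integers $\mathcal O_K$, let $n\ge 2$, let $f(x,y)=f_0x^n+f_1x^{n-1}y+\dots+f_ny^n$ be a binary $n$-ic form with coefficients in $\mathcal O_K$, and let $\mathfrak a$ be a nonzero ideal of $\mathcal O_K$. Let $R_f$ be the ring with underlying $\mathcal O_K$-module $\mathcal O_K^n$, with basis $\zeta_0=1,\zeta_1,\dots,\zeta_{n-1}$, and multiplication (Wood) $$\zeta_i\zeta_j=-\sum_{k=\max(i+j-n,1)}^{i} f_{i+j-k}\,\zeta_k+\sum_{k=j+1}^{\min(i+j,n)} f_{i+j-k}\,\zeta_k\qquad(1\le i\le j\le n-1),\qquad \zeta_n:=-f_n .$$ Let $R_f(\mathfrak a):=\mathcal O_K\zeta_0\oplus\dots\oplus\mathcal O_K\zeta_{n-2}\oplus\mathfrak a^{-1}\zeta_{n-1}\supseteq R_f$, an $\mathcal O_K$-submodule of $K^n$. (1) Suppose that $n\ge 3$, or that $n=2$ and $f_0$ is coprime to $\mathfrak a$ (for example $f_0=1$). Then the module $R_f(\mathfrak a)$ has a (commutative, unital) $\mathcal O_K$-algebra structure extending that of $R_f$ if and only if $f_{n-1}\in\mathfrak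 a$ and $f_n\in\mathfrak a^2$. (2) For every $n\ge 2$: if $f_{n-1}\in\mathfrak a$ and $f_n\in\mathfrak a^2$, then there is exactly one $\mathcal O_K$-algebra structure on $R_f(\mathfrak a)$ extending that of $R_f$; the Steinitz class of $R_f(\mathfrak a)$ is $[\mathfrak a^{-1}]$, that is, an ideal class $c$ satisfies $R_f(\mathfrak a)\simeq\mathcal O_K^{n-1}\oplus I$ as $\mathcal O_K$-modules for some fractional ideal $I$ of class $c$ if and only if $c=[\mathfrak a^{-1}]$; and, for this algebra structure, $\operatorname{Disc}(R_f(\mathfrak a))=\mathfrak a^{-2}\operatorname{Disc}(R_f)$, where the discriminant of a rank $n$ ring $R$ over $\mathcal O_K$ is the ideal generated by all $\det(\operatorname{Tr}(x_ix_j))_{1\le i,j\le n}$ with $x_1,\dots,x_n\in R$. -/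

import Mathlib

open scoped nonZeroDivisors TensorProduct NumberField

noncomputable section

namespace SteinitzRing

/-- A commutative, associative, unital `A`-algebra structure on the `A`-module `M` (inducing the
given module structure): a bilinear multiplication and a unit element. -/
@[ext]
structure AlgebraStructure (A M : Type*) [CommRing A] [AddCommGroup M] [Module A M] where
  mul : M →ₗ[A] M →ₗ[A] M
  one : M
  mul_comm : ∀ x y, mul x y = mul y x
  mul_assoc : ∀ x y z, mul (mul x y) z = mul x (mul y z)
  one_mul : ∀ x, mul one x = x

section Wood

variable {A : Type*} [CommRing A]

/-- The coefficient `f_m` of `x^(n-m) y^m` in the binary `n`-ic form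
`f = f_0 x^n + f_1 x^(n-1) y + ... + f_n y^n` (used for `m ≤ n` only). -/
def formCoeff (n : ℕ) (f : MvPolynomial (Fin 2) A) (m : ℕ) : A :=
  f.coeff (Finsupp.single 0 (n - m) + Finsupp.single 1 m)

/-- `u_1 = ... = u_{n-1} = 1` and `u_n = -f_n`. -/
def woodUnit (n : ℕ) (f : MvPolynomial (Fin 2) A) (k : ℕ) : A :=
  if k = n then -formCoeff n f n else 1

/-- The scalar giving the component `(A)_i ⊗ (A)_j → (A)_k` of the multiplication, for
`1 ≤ i ≤ j ≤ n - 1` and `1 ≤ k ≤ n`, where `(A)_n` means `(A)_0`. -/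
def woodTable (n : ℕ) (f : MvPolynomial (Fin 2) A) (i j k : ℕ) : A :=
  if max (i + j - n) 1 ≤ k ∧ k ≤ i then
    -(formCoeff n f (i + j - k) * woodUnit n f k)
  else if j < k ∧ k ≤ min (i + j) n then
    formCoeff n f (i + j - k) * woodUnit n f k
  else 0

/-- The structure constants of `R_f` on `A^n = (A)_0 ⊕ ... ⊕ (A)_{n-1}`: the generator of `(A)_0`
is the identity, the other products are given by `woodTable`, extended symmetrically in `i, j`. -/
def woodCoeff (n : ℕ) (f : MvPolynomial (Fin 2) A) (i j k : Fin n) : A :=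
  if i.val = 0 then (if j = k then 1 else 0)
  else if j.val = 0 then (if i = k then 1 else 0)
  else woodTable n f (min i.val j.val) (max i.val j.val) (if k.val = 0 then n else k.val)

/-- The multiplication of `R_f` on the module `A^n`. -/
def woodMul (n : ℕ) (f : MvPolynomial (Fin 2) A) :
    (Fin n → A) →ₗ[A] (Fin n → A) →ₗ[A] (Fin n → A) :=
  LinearMap.mk₂ A (fun x y k => ∑ i, ∑ j, x i * y j * woodCoeff n f i j k)
    (fun x x' y => by
      ext k; simp only [Pi.add_apply, add_mul, Finset.sum_add_distrib])
    (fun c x y => by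
      ext k; simp only [Pi.smul_apply, smul_eq_mul, Finset.mul_sum, mul_assoc])
    (fun x y y' => by
      ext k; simp only [Pi.add_apply, mul_add, add_mul, Finset.sum_add_distrib])
    (fun c x y => by
      ext k; simp only [Pi.smul_apply, smul_eq_mul, Finset.mul_sum, mul_assoc, mul_left_comm])

/-- The identity element of `R_f`, the element `1` of `(A)_0`. -/
def woodOne (A : Type*) [CommRing A] (n : ℕ) : Fin n → A :=
  fun i => if i.val = 0 then 1 else 0

end Wood

section Lattice

variable {A : Type*} [CommRing A] [IsDedekindDomain A]
  (K : Type*) [Field K] [Algebra A K] [IsFractionRing A K]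

/-- The invertible fractional ideal `𝔞⁻¹`. -/
def invIdeal (𝔞 : (Ideal A)⁰) : (FractionalIdeal A⁰ K)ˣ :=
  (FractionalIdeal.mk0 K 𝔞)⁻¹

/-- The module `R_f(𝔞) = (A)_0 ⊕ ... ⊕ (A)_{n-2} ⊕ 𝔞⁻¹ (A)_{n-1}`, inside `K^n`. -/
def extModule (n : ℕ) (𝔞 : (Ideal A)⁰) : Submodule A (Fin n → K) :=
  Submodule.pi Set.univ fun i =>
    if i.val + 1 = n then ((invIdeal K 𝔞 : FractionalIdeal A⁰ K) : Submodule A K)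
    else (1 : Submodule A K)

theorem algebraMap_mem_invIdeal (𝔞 : (Ideal A)⁰) (x : A) :
    algebraMap A K x ∈ ((invIdeal K 𝔞 : FractionalIdeal A⁰ K) : Submodule A K) := by
  have h0 : (FractionalIdeal.mk0 K 𝔞 : FractionalIdeal A⁰ K) ≠ 0 := Units.ne_zero _
  have h1 : (FractionalIdeal.mk0 K 𝔞 : FractionalIdeal A⁰ K) ≤ 1 := by
    simpa using FractionalIdeal.coeIdeal_le_one (S := A⁰) (P := K) (I := (𝔞 : Ideal A))
  rw [invIdeal, Units.val_inv_eq_inv_val, FractionalIdeal.mem_coe, FractionalIdeal.mem_inv_iff h0]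
  intro y hy
  obtain ⟨z, rfl⟩ := (FractionalIdeal.mem_one_iff A⁰).1 (h1 hy)
  exact (FractionalIdeal.mem_one_iff A⁰).2 ⟨x * z, by simp⟩

/-- The natural inclusion `R_f ⊆ R_f(𝔞)` of `A`-modules. -/
def incl (n : ℕ) (𝔞 : (Ideal A)⁰) : (Fin n → A) →ₗ[A] extModule K n 𝔞 :=
  LinearMap.codRestrict (extModule K n 𝔞) ((Algebra.linearMap A K).compLeft (Fin n)) <| by
    intro x i _
    dsimp only
    split_ifs
    · exact algebraMap_mem_invIdeal K 𝔞 (x i)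
    · exact Submodule.mem_one.2 ⟨x i, rfl⟩

variable {K} in
/-- The algebra structure `S` on `R_f(𝔞)` extends that of `R_f`. -/
def Extends {n : ℕ} {𝔞 : (Ideal A)⁰} (S : AlgebraStructure A (extModule K n 𝔞))
    (f : MvPolynomial (Fin 2) A) : Prop :=
  S.one = incl K n 𝔞 (woodOne A n) ∧
  ∀ x y : Fin n → A, S.mul (incl K n 𝔞 x) (incl K n 𝔞 y) = incl K n 𝔞 (woodMul n f x y)

/-- `c` is a Steinitz class of the rank `n` module `M`: one has `M ≃ A^{n-1} ⊕ I` for some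
invertible fractional ideal `I` of class `c`. -/
def IsSteinitzClass (n : ℕ) (M : Type*) [AddCommGroup M] [Module A M] (c : ClassGroup A) : Prop :=
  ∃ I : (FractionalIdeal A⁰ K)ˣ, ClassGroup.mk K I = c ∧
    Nonempty (M ≃ₗ[A] (Fin (n - 1) → A) × ((I : FractionalIdeal A⁰ K) : Submodule A K))

end Lattice

section Disc

variable {A : Type*} [CommRing A] (K : Type*) [Field K] [Algebra A K]
  {M : Type*} [AddCommGroup M] [Module A M]

/-- The trace form `(x, y) ↦ Tr(xy)` of a multiplication on `M`, where `Tr z` is the trace of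
multiplication by `z` on the `K`-vector space `K ⊗ M` (`M` itself need not be free). -/
def traceForm (mul : M →ₗ[A] M →ₗ[A] M) (x y : M) : K :=
  LinearMap.trace K (K ⊗[A] M) ((mul (mul x y)).baseChange K)

/-- The discriminant of a rank `n` algebra: the `A`-submodule of `K` generated by all
`det (Tr(x_i x_j))`, for `x_1, ..., x_n` in `M`. -/
def discIdeal (n : ℕ) (mul : M →ₗ[A] M →ₗ[A] M) : Submodule A K :=
  Submodule.span A
    (Set.range fun x : Fin n → M => (Matrix.of fun i j => traceForm K mul (x i) (x j)).det)

end Disc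

end SteinitzRing

end

/-!
An algebra structure on `R_f(𝔞)` extending that of `R_f` agrees, after multiplication by nonzero
scalars, with the multiplication of `R_f`; so it is the restriction to a lattice `⨁ J_i` in `K^n` of
Wood's multiplication over `K`. It is therefore unique, and it exists if and only if that
multiplication preserves the lattice, that is, if and only if each structure constant lies in the
power of `𝔞` that compensates the poles `𝔞⁻¹` of its two arguments.

Wood's multiplication is associative because the `ζ_k` are explicit polynomials in a root `θ` of
`f(x, 1)` which are linearly independent in `A[x] / (f(x, 1))` when `f_0` is regular; the general
case is a specialization of this one.

The determinants of the `n`-tuples of vectors of `⨁ J_i` span `∏ J_i = 𝔞⁻¹`. A change of lattice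
multiplies them by the determinant of a linear map, which gives the Steinitz class, and
`det (Tr (x_i x_j))` is the square of such a determinant times a constant, which gives the
discriminant. Here the squares of generators of a fractional ideal `I` generate `I^2`, since
`I + J` cancels in `(I + J) (I^2 + J^2) = (I + J)^3`.
-/

noncomputable section

namespace SteinitzRing

section Zeta

variable {A Q : Type*} [CommRing A] [CommRing Q] [Algebra A Q]

/-- Wood's elements `ζ_k = c_0 θ^k + c_1 θ^(k-1) + ... + c_(k-1) θ`, in Horner form. The value at
`k = 0` is the empty sum `0`; the basis element that the paper calls `ζ_0 = 1` is not among them. -/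
def zeta (c : ℕ → A) (θ : Q) : ℕ → Q
  | 0 => 0
  | k + 1 => θ * (zeta c θ k + algebraMap A Q (c k))

theorem zeta_succ_mul (c : ℕ → A) (θ : Q) (i j : ℕ) :
    zeta c θ (i + 1) * zeta c θ j =
      zeta c θ i * zeta c θ (j + 1) + (c i • zeta c θ (j + 1) - c j • zeta c θ (i + 1)) := by
  simp only [zeta, Algebra.smul_def]
  ring

theorem zeta_mul_zeta (c : ℕ → A) (θ : Q) (i j : ℕ) :
    zeta c θ i * zeta c θ j =
      ∑ k ∈ Finset.Ioc j (i + j), c (i + j - k) • zeta c θ k -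
        ∑ k ∈ Finset.Ioc 0 i, c (i + j - k) • zeta c θ k := by
  induction i generalizing j with
  | zero => simp [zeta]
  | succ i ih =>
    have hij : i + (j + 1) = i + 1 + j := by ring
    rw [zeta_succ_mul, ih, hij, Finset.sum_Ioc_succ_top i.zero_le,
      ← Finset.sum_Ioc_consecutive _ j.le_succ (by lia : j + 1 ≤ i + 1 + j)]
    simp only [Nat.Ioc_succ_singleton, Finset.sum_singleton]
    rw [(by lia : i + 1 + j - (j + 1) = i), (by lia : i + 1 + j - (i + 1) = j)]
    ring

theorem map_zeta {Q' : Type*} [CommRing Q'] [Algebra A Q'] (φ : Q →ₐ[A] Q') (c : ℕ → A) (θ : Q)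
    (k : ℕ) : φ (zeta c θ k) = zeta c (φ θ) k := by
  induction k with
  | zero => simp [zeta]
  | succ k ih => simp [zeta, ih]

theorem zeta_eq_zero_of_lt {c : ℕ → A} {θ : Q} {n : ℕ} (hc : ∀ m, n < m → c m = 0)
    (hθ : zeta c θ n = -algebraMap A Q (c n)) {k : ℕ} (hk : n < k) : zeta c θ k = 0 := by
  induction k, hk using Nat.le_induction with
  | base => simp [zeta, hθ]
  | succ k hk ih => simp [zeta, ih, hc k hk]

end Zeta

section ZetaPolynomial

open Polynomial

variable {A : Type*} [CommRing A]

theorem natDegree_zeta_X_le (c : ℕ → A) (k : ℕ) : (zeta c (X : A[X]) k).natDegree ≤ k := by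
  induction k with
  | zero => simp [zeta]
  | succ k ih =>
    rw [zeta, add_comm k 1]
    refine natDegree_mul_le_of_le natDegree_X_le (natDegree_add_le_of_degree_le ih ?_)
    simp [algebraMap_eq]

theorem coeff_zeta_X_self (c : ℕ → A) {k : ℕ} (hk : k ≠ 0) :
    (zeta c (X : A[X]) k).coeff k = c 0 := by
  induction k with
  | zero => exact absurd rfl hk
  | succ k ih =>
    rw [zeta, coeff_X_mul, coeff_add, algebraMap_eq]
    rcases eq_or_ne k 0 with rfl | hk'
    · simp [zeta]
    · rw [ih hk', coeff_C_of_ne_zero hk', add_zero]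

theorem eq_zero_of_dvd_of_degree_lt {F P : A[X]} (hF : F.leadingCoeff ∈ A⁰) (hdvd : F ∣ P)
    (hdeg : P.degree < F.degree) : P = 0 := by
  obtain ⟨q, rfl⟩ := hdvd
  by_contra hq
  have hlead : F.leadingCoeff * q.leadingCoeff ≠ 0 := fun h =>
    hq (by rw [leadingCoeff_eq_zero.1 ((mem_nonZeroDivisors_iff.1 hF).1 _ h), mul_zero])
  rw [degree_mul' hlead] at hdeg
  have hq0 : q ≠ 0 := right_ne_zero_of_mul hq
  exact hdeg.not_ge (le_add_of_nonneg_right (zero_le_degree_iff.2 hq0))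

theorem linearIndependent_of_natDegree_le {n : ℕ} {p : Fin n → A[X]}
    (hdeg : ∀ k, (p k).natDegree ≤ k) (hcoeff : ∀ k : Fin n, (p k).coeff k ∈ A⁰) :
    LinearIndependent A p := by
  rw [Fintype.linearIndependent_iff]
  intro x hx
  by_contra! hne
  obtain ⟨k, hk, hmax⟩ := Set.exists_max_image {k | x k ≠ 0} id (Set.toFinite _) hne
  refine hk ((mem_nonZeroDivisors_iff.1 (hcoeff k)).2 _ ?_)
  have hcoeff_zero : ∑ l, x l * (p l).coeff k = 0 := by
    simpa [finsetSum_coeff] using congrArg (coeff · (k : ℕ)) hx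
  rwa [Finset.sum_eq_single_of_mem k (Finset.mem_univ k)] at hcoeff_zero
  intro l _ hlk
  rcases hlk.lt_or_gt with hlt | hgt
  · rw [coeff_eq_zero_of_natDegree_lt ((hdeg l).trans_lt hlt), mul_zero]
  · rw [of_not_not fun hl => (hmax l hl).not_gt hgt, zero_mul]

end ZetaPolynomial

section WoodRing

variable {A : Type*} [CommRing A] {n : ℕ} {f : MvPolynomial (Fin 2) A}

theorem formCoeff_eq_zero_of_lt (hf : f.IsHomogeneous n) {m : ℕ} (hm : n < m) :
    formCoeff n f m = 0 := by
  refine hf.coeff_eq_zero ?_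
  simp only [map_add, Finsupp.degree_single]
  lia

theorem formCoeff_map {B : Type*} [CommRing B] (φ : A →+* B) (n : ℕ) (f : MvPolynomial (Fin 2) A)
    (m : ℕ) : formCoeff n (f.map φ) m = φ (formCoeff n f m) :=
  MvPolynomial.coeff_map _ _ _

theorem woodCoeff_map {B : Type*} [CommRing B] (φ : A →+* B) (n : ℕ) (f : MvPolynomial (Fin 2) A)
    (i j k : Fin n) : woodCoeff n (f.map φ) i j k = φ (woodCoeff n f i j k) := by
  simp only [woodCoeff, woodTable, woodUnit, formCoeff_map, apply_ite φ, map_mul, map_neg,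
    map_zero, map_one]

theorem woodCoeff_comm (n : ℕ) (f : MvPolynomial (Fin 2) A) (i j k : Fin n) :
    woodCoeff n f i j k = woodCoeff n f j i k := by
  grind [woodCoeff]

theorem woodMul_apply (n : ℕ) (f : MvPolynomial (Fin 2) A) (x y : Fin n → A) (k : Fin n) :
    woodMul n f x y k = ∑ i, ∑ j, x i * y j * woodCoeff n f i j k :=
  rfl

theorem woodMul_map {B : Type*} [CommRing B] (φ : A →+* B) (n : ℕ) (f : MvPolynomial (Fin 2) A)
    (x y : Fin n → A) : woodMul n (f.map φ) (φ ∘ x) (φ ∘ y) = φ ∘ woodMul n f x y := by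
  ext k
  simp [woodMul_apply, woodCoeff_map]

theorem woodMul_single (f : MvPolynomial (Fin 2) A) (i j k : Fin n) (a b : A) :
    woodMul n f (Pi.single i a) (Pi.single j b) k = a * b * woodCoeff n f i j k := by
  rw [woodMul_apply, Finset.sum_eq_single i, Finset.sum_eq_single j] <;>
    simp +contextual

theorem woodMul_comm (n : ℕ) (f : MvPolynomial (Fin 2) A) (x y : Fin n → A) :
    woodMul n f x y = woodMul n f y x := by
  ext k
  simp only [woodMul_apply]
  rw [Finset.sum_comm]
  simp only [woodCoeff_comm n f _ _ k, mul_comm (x _)]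

theorem woodOne_mul (n : ℕ) (f : MvPolynomial (Fin 2) A) (x : Fin n → A) :
    woodMul n f (woodOne A n) x = x := by
  cases n with
  | zero => exact Subsingleton.elim _ _
  | succ m =>
    ext k
    simp [woodMul_apply, woodOne, Fin.sum_univ_succ, woodCoeff]

section Root

variable {Q : Type*} [CommRing Q] [Algebra A Q] {θ : Q}

/-- The elements `1, ζ_1, ..., ζ_(n-1)` of an algebra, formed from `θ` and the coefficients of
`f`; the index `n` stands for `0`, as in `woodTable`. When `θ` is a root of `f(x, 1)` they multiply
as the standard basis of `R_f` does. -/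
def woodBasis (n : ℕ) (f : MvPolynomial (Fin 2) A) (θ : Q) (k : ℕ) : Q :=
  if k = 0 ∨ k = n then 1 else zeta (formCoeff n f) θ k

theorem woodUnit_smul_woodBasis
    (hθ : zeta (formCoeff n f) θ n = -algebraMap A Q (formCoeff n f n)) {k : ℕ} (hk : k ≠ 0) :
    woodUnit n f k • woodBasis n f θ k = zeta (formCoeff n f) θ k := by
  rcases eq_or_ne k n with rfl | hkn
  · simp [woodUnit, woodBasis, hθ, Algebra.smul_def]
  · simp [woodUnit, woodBasis, hk, hkn]

theorem woodTable_smul_woodBasis (hf : f.IsHomogeneous n)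
    (hθ : zeta (formCoeff n f) θ n = -algebraMap A Q (formCoeff n f n)) {i j k : ℕ} (hij : i ≤ j)
    (hk : k ∈ Finset.Ioc 0 n) :
    woodTable n f i j k • woodBasis n f θ k =
      (if k ∈ Finset.Ioc j (i + j) then
        formCoeff n f (i + j - k) • zeta (formCoeff n f) θ k else 0) -
      if k ∈ Finset.Ioc 0 i then
        formCoeff n f (i + j - k) • zeta (formCoeff n f) θ k else 0 := by
  obtain ⟨hk0, hkn⟩ := Finset.mem_Ioc.1 hk
  have hunit := woodUnit_smul_woodBasis hθ hk0.ne'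
  simp only [Finset.mem_Ioc, hk0, true_and, woodTable]
  by_cases hki : k ≤ i
  · rw [if_neg (by lia : ¬(j < k ∧ k ≤ i + j)), if_pos hki, zero_sub]
    by_cases hlow : i + j - n ≤ k
    · rw [if_pos (by lia), neg_smul, mul_smul, hunit]
    · rw [if_neg (by lia), if_neg (by lia), formCoeff_eq_zero_of_lt hf (by lia), zero_smul,
        zero_smul, neg_zero]
  · rw [if_neg hki, sub_zero, if_neg (by lia), ite_smul, mul_smul, hunit, zero_smul]
    simp only [le_min_iff, hkn, and_true]

theorem zeta_mul_zeta_eq_sum_woodTable (hf : f.IsHomogeneous n)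
    (hθ : zeta (formCoeff n f) θ n = -algebraMap A Q (formCoeff n f n)) {i j : ℕ} (hij : i ≤ j)
    (hjn : j < n) :
    zeta (formCoeff n f) θ i * zeta (formCoeff n f) θ j =
      ∑ k ∈ Finset.Ioc 0 n, woodTable n f i j k • woodBasis n f θ k := by
  rw [Finset.sum_congr rfl fun k hk => woodTable_smul_woodBasis hf hθ hij hk,
    Finset.sum_sub_distrib, Finset.sum_ite_mem, Finset.sum_ite_mem, zeta_mul_zeta,
    Finset.inter_eq_right.2 (Finset.Ioc_subset_Ioc_right (hij.trans hjn.le))]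
  congr 1
  refine (Finset.sum_subset Finset.inter_subset_right fun k hk hk' => ?_).symm
  have hnk : n < k := by
    simp only [Finset.mem_inter, Finset.mem_Ioc] at hk hk'
    lia
  rw [zeta_eq_zero_of_lt (fun m => formCoeff_eq_zero_of_lt hf) hθ hnk, smul_zero]

theorem sum_fin_ite_eq_sum_Ioc {M : Type*} [AddCommMonoid M] (n : ℕ) (g : ℕ → M) :
    ∑ k : Fin n, g (if k.val = 0 then n else k.val) = ∑ k ∈ Finset.Ioc 0 n, g k := by
  cases n with
  | zero => simp
  | succ m =>
    have hshift : Finset.Ioc 0 m = Finset.Ico (0 + 1) (m + 1) := by grind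
    rw [Fin.sum_univ_succ, Finset.sum_Ioc_succ_top m.zero_le, add_comm, hshift,
      ← Finset.sum_Ico_add', ← Finset.range_eq_Ico, ← Fin.sum_univ_eq_sum_range fun k => g (k + 1)]
    simp

theorem woodBasis_mul_woodBasis (hf : f.IsHomogeneous n)
    (hθ : zeta (formCoeff n f) θ n = -algebraMap A Q (formCoeff n f n)) (i j : Fin n) :
    woodBasis n f θ i * woodBasis n f θ j =
      ∑ k : Fin n, woodCoeff n f i j k • woodBasis n f θ k := by
  wlog hij : i ≤ j generalizing i j
  · simp only [mul_comm (woodBasis n f θ i), this j i (le_of_not_ge hij), woodCoeff_comm n f j i]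
  by_cases hi : i.val = 0
  · simp only [woodCoeff, hi, if_true, ite_smul, one_smul, zero_smul, Finset.sum_ite_eq,
      Finset.mem_univ]
    simp [woodBasis]
  have hj : j.val ≠ 0 := by lia
  have hcyclic (k : Fin n) :
      woodBasis n f θ (if k.val = 0 then n else k.val) = woodBasis n f θ k := by
    split_ifs with hk <;> simp [woodBasis, hk]
  have hzeta (k : Fin n) (hk : k.val ≠ 0) : woodBasis n f θ k = zeta (formCoeff n f) θ k :=
    if_neg (by lia)
  rw [hzeta i hi, hzeta j hj, zeta_mul_zeta_eq_sum_woodTable hf hθ hij j.2,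
    ← sum_fin_ite_eq_sum_Ioc]
  simp only [hcyclic, woodCoeff, hi, hj, if_false, min_eq_left (Fin.le_def.1 hij),
    max_eq_right (Fin.le_def.1 hij)]

variable (n f θ) in
/-- The `A`-linear map from `R_f` to an algebra taking the standard basis to `woodBasis`. It is
multiplicative when `θ` is a root of `f(x, 1)`. -/
def woodEval : (Fin n → A) →ₗ[A] Q :=
  Fintype.linearCombination A fun k : Fin n => woodBasis n f θ k

theorem woodEval_woodMul (hf : f.IsHomogeneous n)
    (hθ : zeta (formCoeff n f) θ n = -algebraMap A Q (formCoeff n f n)) (x y : Fin n → A) :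
    woodEval n f θ (woodMul n f x y) = woodEval n f θ x * woodEval n f θ y := by
  simp only [woodEval, Fintype.linearCombination_apply, Finset.sum_mul_sum, smul_mul_smul_comm,
    woodBasis_mul_woodBasis hf hθ, Finset.smul_sum, smul_smul, woodMul_apply, Finset.sum_smul]
  rw [Finset.sum_comm]
  exact Finset.sum_congr rfl fun i _ => Finset.sum_comm

theorem map_woodEval {Q' : Type*} [CommRing Q'] [Algebra A Q'] (φ : Q →ₐ[A] Q')
    (x : Fin n → A) : φ (woodEval n f θ x) = woodEval n f (φ θ) x := by
  simp [woodEval, Fintype.linearCombination_apply, woodBasis, apply_ite φ, map_zeta]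

end Root

section Associativity

open Polynomial

variable (n f) in
/-- The dehomogenization `f(x, 1) = f_0 x^n + ... + f_n`. -/
def dehomogenize : A[X] :=
  zeta (formCoeff n f) X n + C (formCoeff n f n)

theorem zeta_root_dehomogenize (n : ℕ) (f : MvPolynomial (Fin 2) A) :
    zeta (formCoeff n f) (AdjoinRoot.root (dehomogenize n f)) n =
      -algebraMap A (AdjoinRoot (dehomogenize n f)) (formCoeff n f n) := by
  have hroot : AdjoinRoot.mkₐ (dehomogenize n f)
      (zeta (formCoeff n f) X n + C (formCoeff n f n)) = 0 := AdjoinRoot.mk_self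
  rw [map_add, map_zeta] at hroot
  exact eq_neg_of_add_eq_zero_left hroot

theorem natDegree_woodBasis_X_le (n : ℕ) (f : MvPolynomial (Fin 2) A) (k : ℕ) :
    (woodBasis n f (X : A[X]) k).natDegree ≤ k := by
  unfold woodBasis
  split_ifs
  · simp
  · exact natDegree_zeta_X_le _ k

theorem woodEval_X_mem_degreeLT (x : Fin n → A) : woodEval n f (X : A[X]) x ∈ degreeLT A n := by
  rw [woodEval, Fintype.linearCombination_apply]
  refine Submodule.sum_mem _ fun k _ => Submodule.smul_mem _ _ ?_
  refine mem_degreeLT.2 ((degree_le_of_natDegree_le (natDegree_woodBasis_X_le n f k)).trans_lt ?_)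
  exact_mod_cast k.2

theorem woodEval_X_injective (h0 : formCoeff n f 0 ∈ A⁰) :
    Function.Injective (woodEval n f (X : A[X])) := by
  refine linearIndependent_iff_injective_fintypeLinearCombination.1
    (linearIndependent_of_natDegree_le (fun k => natDegree_woodBasis_X_le n f k) fun k => ?_)
  by_cases hk : k.val = 0
  · simp [woodBasis, hk]
  · rw [woodBasis, if_neg (by lia), coeff_zeta_X_self _ hk]
    exact h0

theorem coeff_dehomogenize_self (hn : n ≠ 0) (f : MvPolynomial (Fin 2) A) :
    (dehomogenize n f).coeff n = formCoeff n f 0 := by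
  rw [dehomogenize, coeff_add, coeff_zeta_X_self _ hn, coeff_C_of_ne_zero hn, add_zero]

theorem natDegree_dehomogenize [Nontrivial A] (hn : n ≠ 0) (h0 : formCoeff n f 0 ∈ A⁰) :
    (dehomogenize n f).natDegree = n := by
  refine natDegree_eq_of_le_of_coeff_ne_zero ?_ ?_
  · rw [dehomogenize, natDegree_add_C]
    exact natDegree_zeta_X_le _ n
  · rw [coeff_dehomogenize_self hn]
    exact nonZeroDivisors.ne_zero h0

theorem woodEval_root_injective (h0 : formCoeff n f 0 ∈ A⁰) :
    Function.Injective (woodEval n f (AdjoinRoot.root (dehomogenize n f))) := by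
  nontriviality A
  rcases eq_or_ne n 0 with rfl | hn
  · exact Function.injective_of_subsingleton _
  have hnat : (dehomogenize n f).natDegree = n := natDegree_dehomogenize hn h0
  have hdeg : (dehomogenize n f).degree = n :=
    (degree_eq_iff_natDegree_eq_of_pos (Nat.pos_of_ne_zero hn)).2 hnat
  have hlead : (dehomogenize n f).leadingCoeff = formCoeff n f 0 := by
    rw [leadingCoeff, hnat, coeff_dehomogenize_self hn]
  refine (injective_iff_map_eq_zero _).2 fun x hx => woodEval_X_injective h0 ?_
  rw [map_zero]
  refine eq_zero_of_dvd_of_degree_lt (hlead ▸ h0) (AdjoinRoot.mk_eq_zero.1 ?_)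
    (hdeg ▸ mem_degreeLT.1 (woodEval_X_mem_degreeLT x))
  exact (map_woodEval (AdjoinRoot.mkₐ (dehomogenize n f)) x).trans hx

theorem woodMul_assoc_of_mem_nonZeroDivisors (hf : f.IsHomogeneous n) (h0 : formCoeff n f 0 ∈ A⁰)
    (x y z : Fin n → A) :
    woodMul n f (woodMul n f x y) z = woodMul n f x (woodMul n f y z) := by
  apply woodEval_root_injective h0
  simp only [woodEval_woodMul hf (zeta_root_dehomogenize n f), mul_assoc]

/-- The witness is `f + X x^n`: its leading coefficient `f_0 + X` is monic in `X`, hence regular. -/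
theorem exists_map_evalRingHom_zero_eq (hf : f.IsHomogeneous n) :
    ∃ g : MvPolynomial (Fin 2) A[X], g.IsHomogeneous n ∧ formCoeff n g 0 ∈ A[X]⁰ ∧
      g.map (evalRingHom 0) = f := by
  refine ⟨f.map C + MvPolynomial.monomial (Finsupp.single 0 n) X,
    (hf.map C).add (MvPolynomial.isHomogeneous_monomial _ (by simp)), ?_, ?_⟩
  · have hlead : formCoeff n (f.map C + MvPolynomial.monomial (Finsupp.single 0 n) X) 0 =
        X + C (formCoeff n f 0) := by
      simp [formCoeff, MvPolynomial.coeff_map, MvPolynomial.coeff_monomial, add_comm]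
    rw [hlead]
    exact (monic_X_add_C _).mem_nonZeroDivisors
  · have hid : (evalRingHom (0 : A)).comp C = RingHom.id A := by ext; simp
    simp [MvPolynomial.map_map, hid, MvPolynomial.map_id]

theorem woodMul_assoc (hf : f.IsHomogeneous n) (x y z : Fin n → A) :
    woodMul n f (woodMul n f x y) z = woodMul n f x (woodMul n f y z) := by
  obtain ⟨g, hg, hg0, rfl⟩ := exists_map_evalRingHom_zero_eq hf
  have hlift (w : Fin n → A) : w = evalRingHom (0 : A) ∘ C ∘ w := by ext; simp
  rw [hlift x, hlift y, hlift z]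
  simp only [woodMul_map, woodMul_assoc_of_mem_nonZeroDivisors hg hg0]

/-- Wood's ring `R_f`. -/
def woodAlgebra (n : ℕ) (f : MvPolynomial (Fin 2) A) (hf : f.IsHomogeneous n) :
    AlgebraStructure A (Fin n → A) where
  mul := woodMul n f
  one := woodOne A n
  mul_comm := woodMul_comm n f
  mul_assoc := woodMul_assoc hf
  one_mul := woodOne_mul n f

end Associativity

end WoodRing

section StructureConstants

variable {A : Type*} [CommRing A] {n : ℕ} {f : MvPolynomial (Fin 2) A} {𝔞 : Ideal A}

/-- The exponent of `𝔞⁻¹` in the `i`-th summand of `R_f(𝔞)`. -/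
def lastExp (n i : ℕ) : ℕ :=
  if i + 1 = n then 1 else 0

theorem sum_lastExp (hn : n ≠ 0) : ∑ i : Fin n, lastExp n i = 1 := by
  obtain ⟨m, rfl⟩ := Nat.exists_eq_succ_of_ne_zero hn
  rw [Fin.sum_univ_castSucc, Finset.sum_eq_zero fun i _ => ?_]
  · simp [lastExp]
  · simp [lastExp, i.2.ne]

theorem woodTable_last_mem (h : formCoeff n f (n - 1) ∈ 𝔞) (i : ℕ) :
    woodTable n f i (n - 1) i ∈ 𝔞 := by
  rw [woodTable, add_tsub_cancel_left]
  split_ifs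
  · exact neg_mem (Ideal.mul_mem_right _ _ h)
  · exact Ideal.mul_mem_right _ _ h
  · exact zero_mem _

theorem woodTable_last_mem_of_ne (hn : n ≠ 0) {I : Ideal A} (h : formCoeff n f n ∈ I) {i k : ℕ}
    (hik : k ≠ i) : woodTable n f i (n - 1) k ∈ I := by
  unfold woodTable
  split_ifs with hlow hhigh
  · rw [(by lia : i + (n - 1) - k = n)]
    exact neg_mem (Ideal.mul_mem_right _ _ h)
  · rw [woodUnit, if_pos (by lia)]
    exact Ideal.mul_mem_left _ _ (neg_mem h)
  · exact zero_mem _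

theorem woodCoeff_mem_pow (hn : 2 ≤ n) (h1 : formCoeff n f (n - 1) ∈ 𝔞)
    (h2 : formCoeff n f n ∈ 𝔞 ^ 2) (i j k : Fin n) :
    woodCoeff n f i j k ∈ 𝔞 ^ (lastExp n i + lastExp n j - lastExp n k) := by
  wlog hij : i.val ≤ j.val generalizing i j
  · rw [woodCoeff_comm, add_comm (lastExp n i)]
    exact this j i (le_of_not_ge hij)
  rcases ne_or_eq (j.val + 1) n with hj | hj
  · have hexp : lastExp n i + lastExp n j - lastExp n k = 0 := by grind [lastExp]
    simp [hexp]
  by_cases hi : i.val = 0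
  · rw [woodCoeff, if_pos hi]
    split_ifs with hjk
    · have hexp : lastExp n i + lastExp n j - lastExp n k = 0 := by grind [lastExp]
      simp [hexp]
    · exact zero_mem _
  rw [woodCoeff, if_neg hi, if_neg (by lia), min_eq_left hij, max_eq_right hij,
    (by lia : j.val = n - 1)]
  rcases eq_or_ne (if k.val = 0 then n else k.val) i with hki | hki
  · rw [hki]
    have hexp : lastExp n i + lastExp n (n - 1) - lastExp n k ≤ 1 := by grind [lastExp]
    exact Ideal.pow_le_pow_right hexp (by rw [pow_one]; exact woodTable_last_mem h1 i)
  · have hexp : lastExp n i + lastExp n (n - 1) - lastExp n k ≤ 2 := by grind [lastExp]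
    exact woodTable_last_mem_of_ne (by lia) (Ideal.pow_le_pow_right hexp h2) hki

theorem woodCoeff_one_last_one (hn : 3 ≤ n) (f : MvPolynomial (Fin 2) A) :
    woodCoeff n f ⟨1, by lia⟩ ⟨n - 1, by lia⟩ ⟨1, by lia⟩ = -formCoeff n f (n - 1) := by
  grind [woodCoeff, woodTable, woodUnit]

theorem woodCoeff_last_last_penultimate (hn : 3 ≤ n) (f : MvPolynomial (Fin 2) A) :
    woodCoeff n f ⟨n - 1, by lia⟩ ⟨n - 1, by lia⟩ ⟨n - 2, by lia⟩ = -formCoeff n f n := by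
  grind [woodCoeff, woodTable, woodUnit]

theorem woodCoeff_two_one_one_one (f : MvPolynomial (Fin 2) A) :
    woodCoeff 2 f 1 1 1 = -formCoeff 2 f 1 := by
  simp [woodCoeff, woodTable, woodUnit]

theorem woodCoeff_two_one_one_zero (f : MvPolynomial (Fin 2) A) :
    woodCoeff 2 f 1 1 0 = -(formCoeff 2 f 0 * formCoeff 2 f 2) := by
  simp [woodCoeff, woodTable, woodUnit]

theorem mem_of_mul_mem_of_isCoprime {a b : A} (h : IsCoprime (Ideal.span {a}) 𝔞)
    (hab : a * b ∈ 𝔞) : b ∈ 𝔞 := by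
  obtain ⟨_, hu, v, hv, huv⟩ := Ideal.isCoprime_iff_exists.1 h
  obtain ⟨w, rfl⟩ := Ideal.mem_span_singleton'.1 hu
  rw [← one_mul b, ← huv, add_mul, mul_assoc]
  exact add_mem (Ideal.mul_mem_left _ _ hab) (Ideal.mul_mem_right _ _ hv)

theorem forall_woodCoeff_mem_pow_iff (hn : 2 ≤ n)
    (h0 : n = 2 → IsCoprime (Ideal.span {formCoeff n f 0}) 𝔞) :
    (∀ i j k : Fin n, woodCoeff n f i j k ∈ 𝔞 ^ (lastExp n i + lastExp n j - lastExp n k)) ↔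
      formCoeff n f (n - 1) ∈ 𝔞 ∧ formCoeff n f n ∈ 𝔞 ^ 2 := by
  refine ⟨fun h => ?_, fun ⟨h1, h2⟩ => woodCoeff_mem_pow hn h1 h2⟩
  rcases hn.eq_or_lt with rfl | hn3
  · have h1 := h 1 1 1
    have h2 := h 1 1 0
    rw [woodCoeff_two_one_one_one, neg_mem_iff] at h1
    rw [woodCoeff_two_one_one_zero, neg_mem_iff] at h2
    exact ⟨by simpa [lastExp] using h1,
      mem_of_mul_mem_of_isCoprime (h0 rfl).pow_right (by simpa [lastExp] using h2)⟩
  · have h1 := h ⟨1, by lia⟩ ⟨n - 1, by lia⟩ ⟨1, by lia⟩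
    have h2 := h ⟨n - 1, by lia⟩ ⟨n - 1, by lia⟩ ⟨n - 2, by lia⟩
    rw [woodCoeff_one_last_one hn3, neg_mem_iff] at h1
    rw [woodCoeff_last_last_penultimate hn3, neg_mem_iff] at h2
    have hlast : lastExp n (n - 1) = 1 := if_pos (by lia)
    have hone : lastExp n 1 = 0 := if_neg (by lia)
    have hpen : lastExp n (n - 2) = 0 := if_neg (by lia)
    exact ⟨by simpa [hlast, hone] using h1, by simpa [hlast, hpen] using h2⟩

end StructureConstants

section Lattice

open scoped Pointwise

variable {A : Type*} [CommRing A] {K : Type*} [Field K] [Algebra A K] {ι : Type*}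
  {J : ι → FractionalIdeal A⁰ K}

/-- The lattice `⨁ J_i` in `K^ι`. -/
def lattice (J : ι → FractionalIdeal A⁰ K) : Submodule A (ι → K) :=
  Submodule.pi Set.univ fun i => (J i : Submodule A K)

theorem mem_lattice {x : ι → K} : x ∈ lattice J ↔ ∀ i, x i ∈ J i := by
  simp only [lattice, Submodule.mem_pi, Set.mem_univ, forall_const, FractionalIdeal.mem_coe]

theorem single_mem_lattice [DecidableEq ι] {i : ι} {a : K} (ha : a ∈ J i) :
    Pi.single i a ∈ lattice J := by
  refine mem_lattice.2 fun k => ?_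
  rcases eq_or_ne k i with rfl | hki
  · rwa [Pi.single_eq_same]
  · rw [Pi.single_eq_of_ne hki]
    exact (J k).zero_mem

theorem map₂_mem_lattice_iff [Finite ι] [DecidableEq ι]
    (B : (ι → K) →ₗ[K] (ι → K) →ₗ[K] (ι → K)) :
    (∀ x ∈ lattice J, ∀ y ∈ lattice J, B x y ∈ lattice J) ↔
      ∀ i j k, ∀ a ∈ J i, ∀ b ∈ J j, a * b * B (Pi.single i 1) (Pi.single j 1) k ∈ J k := by
  have hB (i j k : ι) (a b : K) : B (Pi.single i a) (Pi.single j b) k =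
      a * b * B (Pi.single i 1) (Pi.single j 1) k := by
    rw [← mul_one a, ← mul_one b, ← smul_eq_mul a, ← smul_eq_mul b, Pi.single_smul,
      Pi.single_smul]
    simp [mul_assoc, mul_left_comm b]
  constructor
  · intro h i j k a ha b hb
    rw [← hB]
    exact mem_lattice.1 (h _ (single_mem_lattice ha) _ (single_mem_lattice hb)) k
  · intro h x hx y hy
    refine mem_lattice.2 fun k => ?_
    have := Fintype.ofFinite ι
    rw [← Finset.univ_sum_single x, ← Finset.univ_sum_single y]
    simp only [map_sum, LinearMap.sum_apply, Finset.sum_apply]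
    refine Submodule.sum_mem (J k).coeToSubmodule fun i _ => Submodule.sum_mem _ fun j _ => ?_
    rw [hB]
    exact h _ _ k _ (mem_lattice.1 hx _) _ (mem_lattice.1 hy _)

variable [Fintype ι]

theorem coe_prod_eq_span (J : ι → FractionalIdeal A⁰ K) :
    ((∏ i, J i : FractionalIdeal A⁰ K) : Submodule A K) =
      Submodule.span A (∏ i, ((J i : Submodule A K) : Set K)) := by
  rw [← Submodule.prod_span, ← FractionalIdeal.coeSubmoduleHom_apply, map_prod]
  simp only [FractionalIdeal.coeSubmoduleHom_apply, Submodule.span_eq]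

theorem det_mem_prod [DecidableEq ι] {X : Matrix ι ι K} (hX : ∀ i, X i ∈ lattice J) :
    X.det ∈ ∏ i, J i := by
  rw [Matrix.det_apply, ← FractionalIdeal.mem_coe]
  refine Submodule.sum_mem _ fun σ _ => ?_
  rw [Units.smul_def]
  refine zsmul_mem (S := Submodule A K) ?_ _
  rw [coe_prod_eq_span]
  exact Submodule.subset_span ((Set.mem_fintype_prod _ _).2
    ⟨_, fun i => mem_lattice.1 (hX (σ i)) i, rfl⟩)

variable {M : Type*} [AddCommGroup M] [Module A M]
  {g : M →ₗ[A] (ι → K)}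

theorem span_range_det [DecidableEq ι] (hr : LinearMap.range g = lattice J) :
    Submodule.span A (Set.range fun x : ι → M => (Matrix.of fun i => g (x i)).det) =
      ((∏ i, J i : FractionalIdeal A⁰ K) : Submodule A K) := by
  have hmem (y : ι → K) : y ∈ lattice J ↔ ∃ x, g x = y := by rw [← hr, LinearMap.mem_range]
  refine le_antisymm (Submodule.span_le.2 ?_) ?_
  · rintro _ ⟨x, rfl⟩
    exact det_mem_prod fun i => (hmem _).2 ⟨x i, rfl⟩
  · rw [coe_prod_eq_span]
    refine Submodule.span_mono fun d hd => ?_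
    obtain ⟨a, ha, rfl⟩ := (Set.mem_fintype_prod _ _).1 hd
    choose x hx using fun i => (hmem _).1 (single_mem_lattice (ha i))
    refine ⟨x, ?_⟩
    simp only [hx]
    rw [← Matrix.det_diagonal]
    congr 1
    ext i j
    simp [Matrix.diagonal_apply, Pi.single_apply, eq_comm]

end Lattice

section BaseChange

variable {A : Type*} [CommRing A] {K : Type*} [Field K] [Algebra A K] [IsFractionRing A K]
  {ι : Type*} [Finite ι] {J : ι → FractionalIdeal A⁰ K}

theorem exists_smul_mem_lattice (hJ : ∀ i, J i ≠ 0) (x : ι → K) : ∃ s : A⁰, s • x ∈ lattice J := by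
  have hne (i : ι) : ∃ a ∈ J i, a ≠ 0 := by
    by_contra! h
    exact hJ i (FractionalIdeal.eq_zero_iff.2 h)
  choose a ha ha0 using hne
  obtain ⟨s, hs⟩ := IsLocalization.exist_integer_multiples_of_finite A⁰ fun i => x i / a i
  refine ⟨s, mem_lattice.2 fun i => ?_⟩
  obtain ⟨c, hc⟩ := hs i
  have hsx : (s • x) i = c • a i := by
    rw [Algebra.smul_def, hc, Pi.smul_apply, smul_mul_assoc, div_mul_cancel₀ _ (ha0 i)]
    rfl
  rw [hsx]
  exact (J i).coeToSubmodule.smul_mem c (ha i)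

variable {M : Type*} [AddCommGroup M] [Module A M] {g : M →ₗ[A] (ι → K)}

theorem isBaseChange_of_range_eq_lattice (hg : Function.Injective g)
    (hr : LinearMap.range g = lattice J) (hJ : ∀ i, J i ≠ 0) : IsBaseChange K g := by
  rw [← isLocalizedModule_iff_isBaseChange A⁰]
  refine ⟨fun s => ?_, fun y => ?_, fun h => ⟨1, by rw [hg h]⟩⟩
  · rw [← (Algebra.lsmul A (A := K) A (ι → K)).commutes]
    exact (IsLocalization.map_units K s).map _
  · obtain ⟨s, hs⟩ := exists_smul_mem_lattice hJ y
    rw [← hr] at hs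
    obtain ⟨x, hx⟩ := hs
    exact ⟨(x, s), hx.symm⟩

end BaseChange

theorem spanSingleton_algebraMap_le_coeIdeal_iff {A : Type*} [CommRing A] {K : Type*} [Field K]
    [Algebra A K] [IsFractionRing A K] {I : Ideal A} {c : A} :
    FractionalIdeal.spanSingleton A⁰ (algebraMap A K c) ≤ (I : FractionalIdeal A⁰ K) ↔ c ∈ I := by
  rw [← FractionalIdeal.coeIdeal_span_singleton, FractionalIdeal.coeIdeal_le_coeIdeal,
    Ideal.span_singleton_le_iff_mem]

section ExtModule

variable {A : Type*} [CommRing A] [IsDedekindDomain A]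
  {K : Type*} [Field K] [Algebra A K] [IsFractionRing A K] {n : ℕ} {𝔞 : (Ideal A)⁰}

theorem extModule_eq_lattice (n : ℕ) (𝔞 : (Ideal A)⁰) : extModule K n 𝔞 =
    lattice fun i : Fin n => (invIdeal K 𝔞 : FractionalIdeal A⁰ K) ^ lastExp n i := by
  unfold extModule lattice
  congr 1
  ext1 i
  dsimp only [lastExp]
  split_ifs
  · rw [pow_one]
  · rw [pow_zero, FractionalIdeal.coe_one]

theorem one_le_invIdeal (𝔞 : (Ideal A)⁰) : 1 ≤ (invIdeal K 𝔞 : FractionalIdeal A⁰ K) := by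
  rw [FractionalIdeal.one_le]
  simpa using algebraMap_mem_invIdeal K 𝔞 1

theorem coeIdeal_mul_invIdeal (𝔞 : (Ideal A)⁰) :
    ((𝔞 : Ideal A) : FractionalIdeal A⁰ K) * (invIdeal K 𝔞 : FractionalIdeal A⁰ K) = 1 := by
  rw [← FractionalIdeal.coe_mk0]
  exact Units.mul_inv _

theorem mul_invIdeal_pow_le_pow_iff {I : FractionalIdeal A⁰ K} (hI : I ≤ 1) {m d : ℕ} :
    I * (invIdeal K 𝔞 : FractionalIdeal A⁰ K) ^ m ≤ (invIdeal K 𝔞 : FractionalIdeal A⁰ K) ^ d ↔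
      I ≤ ((𝔞 : Ideal A) : FractionalIdeal A⁰ K) ^ (m - d) := by
  rcases le_total m d with hmd | hdm
  · rw [Nat.sub_eq_zero_of_le hmd, pow_zero]
    refine iff_of_true ?_ hI
    calc I * (invIdeal K 𝔞 : FractionalIdeal A⁰ K) ^ m
        ≤ 1 * (invIdeal K 𝔞 : FractionalIdeal A⁰ K) ^ m := by gcongr
      _ ≤ (invIdeal K 𝔞 : FractionalIdeal A⁰ K) ^ d := by
        rw [one_mul]
        exact pow_le_pow_right' (one_le_invIdeal 𝔞) hmd
  · obtain ⟨e, rfl⟩ := Nat.exists_eq_add_of_le hdm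
    have hpow : (invIdeal K 𝔞 : FractionalIdeal A⁰ K) ^ d =
        ((𝔞 : Ideal A) : FractionalIdeal A⁰ K) ^ e *
          (invIdeal K 𝔞 : FractionalIdeal A⁰ K) ^ (d + e) := by
      rw [add_comm d, pow_add, ← mul_assoc, ← mul_pow, coeIdeal_mul_invIdeal, one_pow, one_mul]
    rw [Nat.add_sub_cancel_left, hpow,
      mul_le_mul_iff_left₀ (pos_iff_ne_zero.2 (pow_ne_zero _ (Units.ne_zero _)))]

theorem mul_mul_mem_invIdeal_pow_iff {c : A} {a b d : ℕ} :
    (∀ α ∈ (invIdeal K 𝔞 : FractionalIdeal A⁰ K) ^ a,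
      ∀ β ∈ (invIdeal K 𝔞 : FractionalIdeal A⁰ K) ^ b,
        α * β * algebraMap A K c ∈ (invIdeal K 𝔞 : FractionalIdeal A⁰ K) ^ d) ↔
      c ∈ (𝔞 : Ideal A) ^ (a + b - d) := by
  rw [← spanSingleton_algebraMap_le_coeIdeal_iff (K := K), FractionalIdeal.coeIdeal_pow,
    ← mul_invIdeal_pow_le_pow_iff, pow_add]
  · constructor
    · intro h
      rw [mul_left_comm, FractionalIdeal.mul_le]
      intro α hα _ hcβ
      obtain ⟨β, hβ, rfl⟩ := FractionalIdeal.mem_singleton_mul.1 hcβ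
      rw [mul_left_comm, mul_comm]
      exact h α hα β hβ
    · intro h α hα β hβ
      rw [mul_comm]
      exact h (FractionalIdeal.mul_mem_mul (FractionalIdeal.mem_spanSingleton_self _ _)
        (FractionalIdeal.mul_mem_mul hα hβ))
  · rw [← FractionalIdeal.coeIdeal_top, spanSingleton_algebraMap_le_coeIdeal_iff]
    exact Submodule.mem_top

theorem woodMul_mem_extModule_iff (f : MvPolynomial (Fin 2) A) :
    (∀ x ∈ extModule K n 𝔞, ∀ y ∈ extModule K n 𝔞,
      woodMul n (f.map (algebraMap A K)) x y ∈ extModule K n 𝔞) ↔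
    ∀ i j k : Fin n,
      woodCoeff n f i j k ∈ (𝔞 : Ideal A) ^ (lastExp n i + lastExp n j - lastExp n k) := by
  rw [extModule_eq_lattice, map₂_mem_lattice_iff]
  simp only [woodMul_single, woodCoeff_map, one_mul, mul_mul_mem_invIdeal_pow_iff]

end ExtModule

section AlgebraStructure

variable {A : Type*} [CommRing A] {K : Type*} [CommRing K] [Algebra A K]
  {V : Type*} [AddCommGroup V] [Module A V] [Module K V] [IsScalarTower A K V]

/-- The `A`-algebra structure on an `A`-submodule that contains the identity and is closed under
the multiplication of a `K`-algebra structure. -/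
def AlgebraStructure.restrict (S : AlgebraStructure K V) (N : Submodule A V) (hone : S.one ∈ N)
    (hmul : ∀ x ∈ N, ∀ y ∈ N, S.mul x y ∈ N) : AlgebraStructure A N where
  mul := LinearMap.mk₂ A (fun x y => ⟨S.mul x y, hmul x x.2 y y.2⟩)
    (fun x x' y => Subtype.ext <| by
      simp only [Submodule.coe_add, map_add, LinearMap.add_apply])
    (fun c x y => Subtype.ext <| by
      simp only [Submodule.coe_smul, LinearMap.map_smul_of_tower, LinearMap.smul_apply])
    (fun x y y' => Subtype.ext <| by simp only [Submodule.coe_add, map_add])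
    (fun c x y => Subtype.ext <| by
      simp only [Submodule.coe_smul, LinearMap.map_smul_of_tower])
  one := ⟨S.one, hone⟩
  mul_comm x y := Subtype.ext (S.mul_comm x y)
  mul_assoc x y z := Subtype.ext (S.mul_assoc x y z)
  one_mul x := Subtype.ext (S.one_mul x)

end AlgebraStructure

section Extension

variable {A : Type*} [CommRing A] [IsDedekindDomain A]
  {K : Type*} [Field K] [Algebra A K] [IsFractionRing A K] {n : ℕ} {𝔞 : (Ideal A)⁰}
  {f : MvPolynomial (Fin 2) A}

theorem exists_smul_eq_incl (x : extModule K n 𝔞) : ∃ (s : A⁰) (y : Fin n → A),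
    s • x = incl K n 𝔞 y := by
  obtain ⟨s, hs⟩ := IsLocalization.exist_integer_multiples_of_finite A⁰ (x : Fin n → K)
  choose y hy using hs
  exact ⟨s, y, Subtype.ext (funext fun i => (hy i).symm)⟩

theorem hom_ext_incl {W : Type*} [AddCommGroup W] [Module A W] [Module.IsTorsionFree A W]
    {φ ψ : extModule K n 𝔞 →ₗ[A] W} (h : ∀ x, φ (incl K n 𝔞 x) = ψ (incl K n 𝔞 x)) : φ = ψ := by
  ext x
  obtain ⟨s, y, hy⟩ := exists_smul_eq_incl x
  have hs : (s : A) • φ x = (s : A) • ψ x := by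
    rw [← map_smul, ← map_smul, ← Submonoid.smul_def, hy, h]
  exact smul_right_injective W (nonZeroDivisors.ne_zero s.2) hs

theorem coe_incl (𝔞 : (Ideal A)⁰) (x : Fin n → A) :
    (incl K n 𝔞 x : Fin n → K) = algebraMap A K ∘ x :=
  rfl

theorem Extends.coe_mul {S : AlgebraStructure A (extModule K n 𝔞)} (h : Extends S f)
    (x y : extModule K n 𝔞) :
    (S.mul x y : Fin n → K) = woodMul n (f.map (algebraMap A K)) x y := by
  let φ : extModule K n 𝔞 →ₗ[A] extModule K n 𝔞 →ₗ[A] (Fin n → K) :=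
    S.mul.compr₂ (extModule K n 𝔞).subtype
  let ψ : extModule K n 𝔞 →ₗ[A] extModule K n 𝔞 →ₗ[A] (Fin n → K) :=
    (woodMul n (f.map (algebraMap A K))).restrictScalars₁₂ A A |>.compl₁₂
      (extModule K n 𝔞).subtype (extModule K n 𝔞).subtype
  suffices φ = ψ from LinearMap.congr_fun₂ this x y
  refine hom_ext_incl fun x => hom_ext_incl fun y => ?_
  change (S.mul (incl K n 𝔞 x) (incl K n 𝔞 y) : Fin n → K) =
    woodMul n (f.map (algebraMap A K)) (incl K n 𝔞 x) (incl K n 𝔞 y)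
  rw [h.2, coe_incl, coe_incl, coe_incl, woodMul_map]

theorem Extends.unique {S T : AlgebraStructure A (extModule K n 𝔞)} (hS : Extends S f)
    (hT : Extends T f) : S = T := by
  refine AlgebraStructure.ext ?_ (hS.1.trans hT.1.symm)
  ext x y : 2
  exact Subtype.ext ((hS.coe_mul x y).trans (hT.coe_mul x y).symm)

theorem coe_incl_woodOne (𝔞 : (Ideal A)⁰) :
    (incl K n 𝔞 (woodOne A n) : Fin n → K) = woodOne K n := by
  ext i
  simp [coe_incl, woodOne, apply_ite (algebraMap A K)]

theorem exists_extends_iff_woodMul_mem (hf : f.IsHomogeneous n) :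
    (∃ S : AlgebraStructure A (extModule K n 𝔞), Extends S f) ↔
      ∀ x ∈ extModule K n 𝔞, ∀ y ∈ extModule K n 𝔞,
        woodMul n (f.map (algebraMap A K)) x y ∈ extModule K n 𝔞 := by
  constructor
  · rintro ⟨S, hS⟩ x hx y hy
    rw [← hS.coe_mul ⟨x, hx⟩ ⟨y, hy⟩]
    exact (S.mul _ _).2
  · intro h
    have hone : woodOne K n ∈ extModule K n 𝔞 := coe_incl_woodOne (K := K) 𝔞 ▸ Subtype.prop _
    exact ⟨(woodAlgebra n _ (hf.map (algebraMap A K))).restrict (extModule K n 𝔞) hone h,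
      Subtype.ext (coe_incl_woodOne 𝔞).symm,
      fun x y => Subtype.ext (woodMul_map (algebraMap A K) n f x y)⟩

end Extension

section Steinitz

section SnocMap

variable {A : Type*} [CommRing A] {K : Type*} [Field K] [Algebra A K]

/-- The coordinates of `A^m ⊕ I` in `K^(m+1)`. -/
def snocMap (m : ℕ) (I : FractionalIdeal A⁰ K) :
    ((Fin m → A) × (I : Submodule A K)) →ₗ[A] (Fin (m + 1) → K) where
  toFun p := Fin.snoc (α := fun _ => K) (fun i => algebraMap A K (p.1 i)) (p.2 : K)
  map_add' p q := by
    ext i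
    refine Fin.lastCases ?_ (fun i => ?_) i <;> simp
  map_smul' c p := by
    ext i
    refine Fin.lastCases ?_ (fun i => ?_) i <;> simp [Algebra.smul_def]

variable (m : ℕ) (I : FractionalIdeal A⁰ K)

theorem snocMap_castSucc (p : (Fin m → A) × (I : Submodule A K)) (i : Fin m) :
    snocMap m I p i.castSucc = algebraMap A K (p.1 i) :=
  Fin.snoc_castSucc (α := fun _ => K) (p.2 : K) (fun i => algebraMap A K (p.1 i)) i

theorem snocMap_last (p : (Fin m → A) × (I : Submodule A K)) :
    snocMap m I p (Fin.last m) = p.2 :=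
  Fin.snoc_last (α := fun _ => K) (p.2 : K) (fun i => algebraMap A K (p.1 i))

theorem snocMap_injective [FaithfulSMul A K] : Function.Injective (snocMap m I) := by
  intro p q h
  refine Prod.ext (funext fun i => ?_) (Subtype.ext ?_)
  · refine FaithfulSMul.algebraMap_injective A K ?_
    rw [← snocMap_castSucc, ← snocMap_castSucc, h]
  · rw [← snocMap_last, ← snocMap_last, h]

theorem range_snocMap :
    LinearMap.range (snocMap m I) = lattice fun i : Fin (m + 1) => I ^ lastExp (m + 1) i := by
  have hlast : I ^ lastExp (m + 1) (Fin.last m) = I := by simp [lastExp]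
  have hinit (i : Fin m) : I ^ lastExp (m + 1) i.castSucc = 1 := by simp [lastExp, i.2.ne]
  ext x
  rw [mem_lattice, Fin.forall_fin_succ', LinearMap.mem_range]
  simp only [hlast, hinit, FractionalIdeal.mem_one_iff]
  constructor
  · rintro ⟨p, rfl⟩
    exact ⟨fun i => ⟨p.1 i, (snocMap_castSucc m I p i).symm⟩, (snocMap_last m I p).symm ▸ p.2.2⟩
  · rintro ⟨h, hx⟩
    choose a ha using h
    refine ⟨(a, ⟨x (Fin.last m), hx⟩), funext fun i => ?_⟩
    refine Fin.lastCases ?_ (fun i => ?_) i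
    · exact snocMap_last ..
    · exact (snocMap_castSucc ..).trans (ha i)

end SnocMap

variable {A : Type*} [CommRing A] {K : Type*} [Field K] [Algebra A K] [IsFractionRing A K]

theorem exists_prod_eq_spanSingleton_mul {ι M : Type*} [Fintype ι] [AddCommGroup M] [Module A M]
    {g g' : M →ₗ[A] (ι → K)} {J J' : ι → FractionalIdeal A⁰ K} (hJ : ∀ i, J i ≠ 0)
    (hg : Function.Injective g) (hr : LinearMap.range g = lattice J)
    (hr' : LinearMap.range g' = lattice J') :
    ∃ d : K, ∏ i, J' i = FractionalIdeal.spanSingleton A⁰ d * ∏ i, J i := by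
  classical
  let T : (ι → K) →ₗ[K] (ι → K) := (isBaseChange_of_range_eq_lattice hg hr hJ).lift g'
  have hT (x : ι → M) : (Matrix.of fun i => g' (x i)).det =
      (LinearMap.toMatrix' T).det * (Matrix.of fun i => g (x i)).det := by
    rw [mul_comm, ← Matrix.det_transpose (LinearMap.toMatrix' T), ← Matrix.det_mul]
    congr 1
    ext i j
    rw [Matrix.mul_apply_eq_vecMul, Matrix.vecMul_transpose, ← Matrix.toLin'_apply,
      Matrix.toLin'_toMatrix']
    exact (congrFun (IsBaseChange.lift_eq _ g' (x i)) j).symm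
  refine ⟨(LinearMap.toMatrix' T).det, FractionalIdeal.coeToSubmodule_injective ?_⟩
  dsimp only
  rw [FractionalIdeal.coe_mul, FractionalIdeal.coe_spanSingleton, ← span_range_det hr,
    ← span_range_det hr', Submodule.span_mul_span, Set.singleton_mul, ← Set.range_comp]
  congr 2
  exact funext hT

theorem isSteinitzClass_extModule_iff [IsDedekindDomain A] {n : ℕ} (hn : n ≠ 0) (𝔞 : (Ideal A)⁰)
    (c : ClassGroup A) :
    IsSteinitzClass K n (extModule K n 𝔞) c ↔ c = ClassGroup.mk K (invIdeal K 𝔞) := by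
  have hprod (I : FractionalIdeal A⁰ K) : ∏ i : Fin n, I ^ lastExp n i = I := by
    rw [Finset.prod_pow_eq_pow_sum, sum_lastExp hn, pow_one]
  have hsub := (extModule K n 𝔞).range_subtype.trans (extModule_eq_lattice n 𝔞)
  obtain ⟨m, rfl⟩ := Nat.exists_eq_succ_of_ne_zero hn
  constructor
  · rintro ⟨I, rfl, ⟨e⟩⟩
    have hrange := (e.range_comp (snocMap m (I : FractionalIdeal A⁰ K))).trans
      (range_snocMap m (I : FractionalIdeal A⁰ K))
    obtain ⟨d, hd⟩ := exists_prod_eq_spanSingleton_mul (fun i => pow_ne_zero _ (Units.ne_zero _))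
      (Submodule.subtype_injective _) hsub hrange
    rw [hprod, hprod] at hd
    rw [← mul_inv_eq_one, ← map_inv, ← map_mul, ClassGroup.mk_eq_one_iff, Units.val_mul, hd,
      mul_assoc, Units.mul_inv, mul_one, FractionalIdeal.coe_spanSingleton]
    exact ⟨_, rfl⟩
  · rintro rfl
    refine ⟨invIdeal K 𝔞, rfl, ⟨(LinearEquiv.ofEq _ _ ?_).trans
      (LinearEquiv.ofInjective _ (snocMap_injective m (invIdeal K 𝔞 : FractionalIdeal A⁰ K))).symm⟩⟩
    rw [range_snocMap, extModule_eq_lattice]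

end Steinitz

section Discriminant

variable {A : Type*} [CommRing A] {K : Type*} [Field K] [Algebra A K]

theorem trace_baseChange_eq {M V : Type*} [AddCommGroup M] [Module A M] [AddCommGroup V]
    [Module A V] [Module K V] [IsScalarTower A K V] {g : M →ₗ[A] V} (hg : IsBaseChange K g)
    (L : M →ₗ[A] M) (T : V →ₗ[K] V) (h : ∀ x, T (g x) = g (L x)) :
    LinearMap.trace K (K ⊗[A] M) (L.baseChange K) = LinearMap.trace K V T := by
  rw [← LinearMap.trace_conj' _ hg.equiv]
  congr 1
  refine hg.algHom_ext _ _ fun x => ?_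
  rw [LinearEquiv.conj_apply_apply, hg.equiv_symm_apply, LinearMap.baseChange_tmul,
    hg.equiv_tmul, one_smul, h]

/-- The trace form `(x, y) ↦ Tr(xy)` of a multiplication on a vector space. -/
def traceBilin {V : Type*} [AddCommGroup V] [Module K V] (B : V →ₗ[K] V →ₗ[K] V) :
    LinearMap.BilinForm K V :=
  B.compr₂ (LinearMap.trace K V ∘ₗ B)

/-- The discriminant of a multiplication on `K^ι`, relative to the standard basis. -/
def mulDisc {ι : Type*} [Fintype ι] [DecidableEq ι] (B : (ι → K) →ₗ[K] (ι → K) →ₗ[K] (ι → K)) : K :=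
  (LinearMap.BilinForm.toMatrix' (traceBilin B)).det

section TraceForm

variable {M V : Type*} [AddCommGroup M] [Module A M]
  {mul : M →ₗ[A] M →ₗ[A] M}

theorem traceForm_eq_traceBilin [AddCommGroup V] [Module A V] [Module K V] [IsScalarTower A K V]
    {B : V →ₗ[K] V →ₗ[K] V} {g : M →ₗ[A] V} (hg : IsBaseChange K g)
    (h : ∀ x y, g (mul x y) = B (g x) (g y)) (x y : M) :
    traceForm K mul x y = traceBilin B (g x) (g y) := by
  rw [traceForm, trace_baseChange_eq hg _ (B (g (mul x y))) fun z => (h _ z).symm, h]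
  rfl

theorem det_traceForm {ι : Type*} [Fintype ι] [DecidableEq ι]
    {B : (ι → K) →ₗ[K] (ι → K) →ₗ[K] (ι → K)} {g : M →ₗ[A] (ι → K)} (hg : IsBaseChange K g)
    (h : ∀ x y, g (mul x y) = B (g x) (g y)) (x : ι → M) :
    (Matrix.of fun i j => traceForm K mul (x i) (x j)).det =
      (Matrix.of fun i => g (x i)).det ^ 2 * mulDisc B := by
  have hmat : (Matrix.of fun i j => traceForm K mul (x i) (x j)) =
      (Matrix.of fun i => g (x i)) * LinearMap.BilinForm.toMatrix' (traceBilin B) *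
        (Matrix.of fun i => g (x i)).transpose := by
    ext i j
    rw [Matrix.mul_mul_apply, ← Matrix.toBilin'_apply', Matrix.toBilin'_toMatrix']
    exact traceForm_eq_traceBilin hg h _ _
  rw [hmat, Matrix.det_mul, Matrix.det_mul, Matrix.det_transpose, mulDisc]
  ring

end TraceForm

variable [IsDedekindDomain A] [IsFractionRing A K]

theorem mul_le_sq_add_sq (I J : FractionalIdeal A⁰ K) : I * J ≤ I ^ 2 + J ^ 2 := by
  rcases eq_or_ne (I + J) 0 with h | h
  · have hI : I = 0 := le_bot_iff.1 ((le_sup_left : I ≤ I ⊔ J).trans h.le)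
    rw [hI, zero_mul]
    exact bot_le
  · rw [← mul_le_mul_iff_right₀ (pos_iff_ne_zero.2 h)]
    calc (I + J) * (I * J) ≤ (I + J) * (I * J) + (I ^ 3 + J ^ 3) := le_sup_left
      _ = (I + J) * (I ^ 2 + J ^ 2) := by ring

theorem mul_mem_span_sq (a b : K) : a * b ∈ Submodule.span A {a ^ 2, b ^ 2} := by
  have h := mul_le_sq_add_sq (FractionalIdeal.spanSingleton A⁰ a)
    (FractionalIdeal.spanSingleton A⁰ b)
  rw [FractionalIdeal.spanSingleton_mul_spanSingleton, FractionalIdeal.spanSingleton_le_iff_mem,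
    FractionalIdeal.spanSingleton_pow, FractionalIdeal.spanSingleton_pow,
    ← FractionalIdeal.mem_coe, FractionalIdeal.coe_add, FractionalIdeal.coe_spanSingleton,
    FractionalIdeal.coe_spanSingleton, Submodule.add_eq_sup, ← Submodule.span_union] at h
  exact h

theorem span_image_sq (s : Set K) :
    Submodule.span A ((fun a => a ^ 2) '' s) = Submodule.span A s ^ 2 := by
  refine le_antisymm (Submodule.span_le.2 ?_) ?_
  · rintro _ ⟨a, ha, rfl⟩
    exact Submodule.pow_mem_pow _ (Submodule.subset_span ha) 2
  · rw [sq, Submodule.span_mul_span, Submodule.span_le]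
    rintro _ ⟨a, ha, b, hb, rfl⟩
    have hsub : {a ^ 2, b ^ 2} ⊆ (fun a => a ^ 2) '' s :=
      Set.pair_subset (Set.mem_image_of_mem _ ha) (Set.mem_image_of_mem _ hb)
    exact Submodule.span_mono hsub (mul_mem_span_sq a b)

theorem discIdeal_eq_mul_span_mulDisc {M : Type*} [AddCommGroup M] [Module A M] {n : ℕ}
    {mul : M →ₗ[A] M →ₗ[A] M} {B : (Fin n → K) →ₗ[K] (Fin n → K) →ₗ[K] (Fin n → K)}
    {g : M →ₗ[A] (Fin n → K)} {J : Fin n → FractionalIdeal A⁰ K} (hJ : ∀ i, J i ≠ 0)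
    (hg : Function.Injective g) (hr : LinearMap.range g = lattice J)
    (h : ∀ x y, g (mul x y) = B (g x) (g y)) :
    discIdeal K n mul = (((∏ i, J i) ^ 2 : FractionalIdeal A⁰ K) : Submodule A K) *
      Submodule.span A {mulDisc B} := by
  simp only [discIdeal, det_traceForm (isBaseChange_of_range_eq_lattice hg hr hJ) h]
  rw [FractionalIdeal.coe_pow, ← span_range_det hr, ← span_image_sq, Submodule.span_mul_span,
    ← Set.range_comp, Set.mul_singleton, ← Set.range_comp]
  rfl

theorem discIdeal_woodMul (n : ℕ) (f : MvPolynomial (Fin 2) A) :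
    discIdeal K n (woodMul n f) =
      Submodule.span A {mulDisc (woodMul n (f.map (algebraMap A K)))} := by
  let g : (Fin n → A) →ₗ[A] (Fin n → K) := (Algebra.linearMap A K).compLeft (Fin n)
  have hr : LinearMap.range g = lattice fun _ => 1 := by
    ext x
    simp only [mem_lattice, FractionalIdeal.mem_one_iff, LinearMap.mem_range]
    exact ⟨fun ⟨y, hy⟩ i => ⟨y i, congrFun hy i⟩, fun hx => ⟨_, funext fun i => (hx i).choose_spec⟩⟩
  have hg : Function.Injective g := (IsFractionRing.injective A K).comp_left
  have hone (_ : Fin n) : (1 : FractionalIdeal A⁰ K) ≠ 0 := one_ne_zero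
  rw [discIdeal_eq_mul_span_mulDisc hone hg hr
    fun x y => (woodMul_map (algebraMap A K) n f x y).symm]
  simp only [Finset.prod_const_one, one_pow, FractionalIdeal.coe_one, one_mul]

theorem Extends.discIdeal_eq {n : ℕ} (hn : n ≠ 0) {𝔞 : (Ideal A)⁰}
    {S : AlgebraStructure A (extModule K n 𝔞)} {f : MvPolynomial (Fin 2) A} (h : Extends S f) :
    discIdeal K n S.mul =
      (((invIdeal K 𝔞 : FractionalIdeal A⁰ K) ^ 2 : FractionalIdeal A⁰ K) : Submodule A K) *
        discIdeal K n (woodMul n f) := by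
  rw [discIdeal_woodMul, discIdeal_eq_mul_span_mulDisc (fun i => pow_ne_zero _ (Units.ne_zero _))
    (Submodule.subtype_injective _)
    ((extModule K n 𝔞).range_subtype.trans (extModule_eq_lattice n 𝔞)) h.coe_mul,
    Finset.prod_pow_eq_pow_sum, sum_lastExp hn, pow_one]

end Discriminant

end SteinitzRing

end

open SteinitzRing in
theorem mainTheorem3_general {A : Type*} [CommRing A] [IsDedekindDomain A]
    (K : Type*) [Field K] [Algebra A K] [IsFractionRing A K] {n : ℕ} (hn : 2 ≤ n)
    {f : MvPolynomial (Fin 2) A} (hf : f.IsHomogeneous n) (𝔞 : (Ideal A)⁰) :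
    ((n = 2 → IsCoprime (Ideal.span {formCoeff n f 0}) (𝔞 : Ideal A)) →
      ((∃ S : AlgebraStructure A (extModule K n 𝔞), Extends S f) ↔
        formCoeff n f (n - 1) ∈ (𝔞 : Ideal A) ∧ formCoeff n f n ∈ (𝔞 : Ideal A) ^ 2)) ∧
    (formCoeff n f (n - 1) ∈ (𝔞 : Ideal A) → formCoeff n f n ∈ (𝔞 : Ideal A) ^ 2 →
      ∃! S : AlgebraStructure A (extModule K n 𝔞), Extends S f) ∧
    (∀ c : ClassGroup A,
      IsSteinitzClass K n (extModule K n 𝔞) c ↔ c = ClassGroup.mk K (invIdeal K 𝔞)) ∧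
    (∀ S : AlgebraStructure A (extModule K n 𝔞), Extends S f →
      discIdeal K n S.mul =
        (((invIdeal K 𝔞 : FractionalIdeal A⁰ K) ^ 2 : FractionalIdeal A⁰ K) : Submodule A K) *
          discIdeal K n (woodMul n f)) := by
  have hn0 : n ≠ 0 := by lia
  refine ⟨fun h0 => ?_, fun h1 h2 => ?_, isSteinitzClass_extModule_iff hn0 𝔞,
    fun S hS => hS.discIdeal_eq hn0⟩
  · rw [exists_extends_iff_woodMul_mem (K := K) hf, woodMul_mem_extModule_iff,
      forall_woodCoeff_mem_pow_iff hn h0]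
  · obtain ⟨S, hS⟩ := (exists_extends_iff_woodMul_mem (K := K) hf).2
      ((woodMul_mem_extModule_iff f).2 (woodCoeff_mem_pow hn h1 h2))
    exact ⟨S, hS, fun T hT => hT.unique hS⟩

theorem mainTheorem3 (K : Type*) [Field K] [NumberField K] (n : ℕ) (hn : 2 ≤ n)
    (f : MvPolynomial (Fin 2) (𝓞 K)) (hf : f.IsHomogeneous n) (𝔞 : (Ideal (𝓞 K))⁰) :
    ((n = 2 → IsCoprime (Ideal.span {SteinitzRing.formCoeff n f 0}) (𝔞 : Ideal (𝓞 K))) →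
      ((∃ S : SteinitzRing.AlgebraStructure (𝓞 K) (SteinitzRing.extModule K n 𝔞),
          SteinitzRing.Extends S f) ↔
        SteinitzRing.formCoeff n f (n - 1) ∈ (𝔞 : Ideal (𝓞 K)) ∧
          SteinitzRing.formCoeff n f n ∈ (𝔞 : Ideal (𝓞 K)) ^ 2)) ∧
    (SteinitzRing.formCoeff n f (n - 1) ∈ (𝔞 : Ideal (𝓞 K)) →
      SteinitzRing.formCoeff n f n ∈ (𝔞 : Ideal (𝓞 K)) ^ 2 →
      (∃! S : SteinitzRing.AlgebraStructure (𝓞 K) (SteinitzRing.extModule K n 𝔞),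
          SteinitzRing.Extends S f) ∧
      (∀ c : ClassGroup (𝓞 K),
        SteinitzRing.IsSteinitzClass K n (SteinitzRing.extModule K n 𝔞) c ↔
          c = ClassGroup.mk K (SteinitzRing.invIdeal K 𝔞)) ∧
      (∀ S : SteinitzRing.AlgebraStructure (𝓞 K) (SteinitzRing.extModule K n 𝔞),
        SteinitzRing.Extends S f →
          SteinitzRing.discIdeal K n S.mul =
            (((SteinitzRing.invIdeal K 𝔞 : FractionalIdeal (𝓞 K)⁰ K) ^ 2 :
                FractionalIdeal (𝓞 K)⁰ K) : Submodule (𝓞 K) K) *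
              SteinitzRing.discIdeal K n (SteinitzRing.woodMul n f))) := by
  obtain ⟨hiff, hunique, hclass, hdisc⟩ := mainTheorem3_general K hn hf 𝔞
  exact ⟨hiff, fun h1 h2 => ⟨hunique h1 h2, hclass, hdisc⟩⟩
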